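/- Let $X, Z$ denote real random variables, and let $X_1, X_2, \ldots$ be i.i.d. copies of $X$. Write $X \in DOA^\vee(Z)$ if there are $a_n > 0$ and $b_n \in \mathbb{R}$ such that $a_n \max\{X_1,\ldots,X_n\} - b_n$ converges in distribution to $Z$. Write $Z \in \mathcal{D}^-$ if, for all $n$ and all $\theta_1,\ldots,\theta_n \ge 0$ with $\sum_{i=1}^n \theta_i = 1$, and for i.i.d. copies $Z_1,\ldots,Z_n$ of $Z$, $$P\Big(\sum_{i=1}^n \theta_i Z_i \le t\Big) \le P(Z \le t) \quad \text{for all } t \in \mathbb{R}.$$ Call $Z$ a Fréchet random variable with parameter $\alpha > 0$ if, for some location $m \in \mathbb{R}$ and some scale $s > 0$, $P(Z \le x) = \exp\big(-((x-m)/s)^{-\alpha}\big)$ for $x > m$ and $P(Z \le x) = 0$ for $x \le m$. Call $Z$ max-stable if it is non-degenerate (not almost surely constant) and for every $n \ge 1$ there are $a > 0$ and $b \in \mathbb{R}$ such that $a \max\{Z_1,\ldots,Z_n\} - b$ has the same distribution as $Z$. (i) If $Z$ is non-degenerate and $X \in DOA^\vee(Z)$ for some $X$, then $Z \in \mathcal{D}^-$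 if and only if $Z$ is a Fréchet random variable with some parameter $0 < \alpha \le 1$. (ii) Every Fréchet random variable $Z$ with parameter $0 < \alpha \le 1$ is max-stable, and there is an $X$ with $X \in DOA^\vee(Z)$. Consequently, a non-degenerate $Z$ satisfies "$X \in DOA^\vee(Z)$ for some $X$, and $Z \in \mathcal{D}^-$" if and only if $Z$ is Fréchet with parameter $0 < \alpha \le 1$. -/

import Mathlib

open MeasureTheory ProbabilityTheory Filter Topology

noncomputable section

namespace MaxStableDiv

/-- The usual stochastic order `X ≤_st Y`, for the laws `μ` of `X` and `ν` of `Y`: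
`F_X t ≥ F_Y t` for all real `t`. -/
def StLE (μ ν : Measure ℝ) : Prop :=
  ∀ t : ℝ, cdf ν t ≤ cdf μ t

/-- The law of `∑ i, θ i * X i`, where the `X i` are i.i.d. with law `μ`. -/
def combLaw (μ : Measure ℝ) {n : ℕ} (θ : Fin n → ℝ) : Measure ℝ :=
  (Measure.pi (fun _ : Fin n => μ)).map (fun x => ∑ i, θ i * x i)

/-- The class `𝓓⁻`: `X₁ ≤_st ∑ i, θ i * X i` for all finite systems of convex weights `θ`, where the
`X i` are i.i.d. with law `μ`. -/
def DMinus (μ : Measure ℝ) : Prop :=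
  ∀ (n : ℕ) (θ : Fin n → ℝ), (∀ i, 0 ≤ θ i) → ∑ i, θ i = 1 → StLE μ (combLaw μ θ)

/-- Convergence in distribution of a sequence of laws: pointwise convergence of the distribution
functions at the continuity points of the limiting distribution function. -/
def ConvInDist (μs : ℕ → Measure ℝ) (ν : Measure ℝ) : Prop :=
  ∀ t : ℝ, ContinuousAt (cdf ν) t → Tendsto (fun n => cdf (μs n) t) atTop (𝓝 (cdf ν t))

/-- The law of `a * max {X₀, …, Xₙ} - b`, where `X₀, …, Xₙ` are `n + 1` i.i.d. random variables with
law `μ`. -/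
def normMaxLaw (μ : Measure ℝ) (n : ℕ) (a b : ℝ) : Measure ℝ :=
  (Measure.pi (fun _ : Fin (n + 1) => μ)).map
    (fun x => a * Finset.univ.sup' Finset.univ_nonempty x - b)

/-- `X ∈ DOA^∨(Z)`, for the laws `μ` of `X` and `ν` of `Z`: suitably normalised maxima of i.i.d.
copies of `X` converge in distribution to `Z`. -/
def InMaxDOA (μ ν : Measure ℝ) : Prop :=
  ∃ a b : ℕ → ℝ, (∀ n, 0 < a n) ∧ ConvInDist (fun n => normMaxLaw μ n (a n) (b n)) ν

/-- The law is not concentrated at a single point. -/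
def Nondegenerate (μ : Measure ℝ) : Prop :=
  ∀ c : ℝ, μ ≠ Measure.dirac c

/-- Max-stability: `ν` is non-degenerate, and for every sample size the maximum of i.i.d. random
variables with law `ν` has law `ν` again after a suitable normalisation. -/
def IsMaxStable (ν : Measure ℝ) : Prop :=
  Nondegenerate ν ∧ ∀ n : ℕ, ∃ a b : ℝ, 0 < a ∧ normMaxLaw ν n a b = ν

/-- `ν` is a Fréchet law with shape `α` (with some location `m` and some scale `s > 0`). -/
def IsFrechet (α : ℝ) (ν : Measure ℝ) : Prop :=
  ∃ m s : ℝ, 0 < s ∧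
    ∀ x : ℝ, cdf ν x = if x ≤ m then 0 else Real.exp (-(((x - m) / s) ^ (-α)))

end MaxStableDiv

end

namespace MaxStableDiv

/-! Let F be the distribution function of Z. If Z is Fréchet with location m and parameter α ≤ 1,
then ∑ θ_i (Z_i - m) ≥ max θ_i (Z_i - m) ≥ max θ_i^(1/α) (Z_i - m), and the last maximum has the law
of Z - m because the weights sum to one (`IsFrechet.dMinus`).

Conversely, convergence of types (`exists_affine_of_tendsto_comp`) turns the limit theorem into
F(a_t x + b_t) = F(x)^t for every real t > 0, and everything hinges on a_2. If a_2 > 1/2, iterating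
the equation for t = 2 bounds both tails well enough for a finite mean
(`integrable_id_of_cdf_affine_eq_sq`); the law of large numbers for equal weights then forces Z ≤ E
Z almost surely, so Z is constant (`DMinus.not_integrable`). Hence a_2 ≤ 1/2. The affine maps
commute and share a fixed point m, a_t = t^(-ρ) with ρ ≥ 1, and F is Fréchet with parameter 1/ρ
(`exists_isFrechet_of_cdf_affine_eq_rpow`). The Gumbel and Weibull types need no separate treatment:
they have a_2 ≥ 1. -/

theorem measurable_normMax (n : ℕ) (a b : ℝ) :
    Measurable (fun x : Fin (n + 1) → ℝ => a * Finset.univ.sup' Finset.univ_nonempty x - b) := by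
  have h := Finset.measurable_sup' (s := (Finset.univ : Finset (Fin (n + 1)))) Finset.univ_nonempty
    (f := fun i (x : Fin (n + 1) → ℝ) => x i) (fun i _ => measurable_pi_apply i)
  convert (h.const_mul a).sub_const b using 3 with x
  rw [Finset.sup'_apply]

theorem isProbabilityMeasure_normMaxLaw (μ : Measure ℝ) [IsProbabilityMeasure μ] (n : ℕ)
    (a b : ℝ) : IsProbabilityMeasure (normMaxLaw μ n a b) :=
  Measure.isProbabilityMeasure_map (measurable_normMax n a b).aemeasurable

theorem isProbabilityMeasure_combLaw (μ : Measure ℝ) [IsProbabilityMeasure μ] {n : ℕ}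
    (θ : Fin n → ℝ) : IsProbabilityMeasure (combLaw μ θ) :=
  Measure.isProbabilityMeasure_map (Measurable.aemeasurable (by fun_prop))

/-- The distribution function of a normalised maximum. -/
theorem cdf_normMaxLaw (μ : Measure ℝ) [IsProbabilityMeasure μ] (n : ℕ) {a : ℝ} (ha : 0 < a)
    (b t : ℝ) : cdf (normMaxLaw μ n a b) t = cdf μ ((t + b) / a) ^ (n + 1) := by
  have := isProbabilityMeasure_normMaxLaw μ n a b
  rw [cdf_eq_real, cdf_eq_real, measureReal_def, measureReal_def, normMaxLaw,
    Measure.map_apply (measurable_normMax n a b) measurableSet_Iic]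
  have : (fun x : Fin (n + 1) → ℝ => a * Finset.univ.sup' Finset.univ_nonempty x - b) ⁻¹'
      Set.Iic t = Set.univ.pi (fun _ => Set.Iic ((t + b) / a)) := by
    ext x
    simp only [Set.mem_preimage, Set.mem_Iic, Set.mem_pi, Set.mem_univ, true_imp_iff]
    rw [sub_le_iff_le_add, ← le_div_iff₀' ha, Finset.sup'_le_iff]
    simp
  rw [this, Measure.pi_pi]
  simp

/-- A probability measure whose distribution function has no value strictly between `0` and `1`
is concentrated at a point. -/
theorem Nondegenerate.exists_cdf_mem_Ioo {ν : Measure ℝ} [IsProbabilityMeasure ν]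
    (h : Nondegenerate ν) : ∃ x, 0 < cdf ν x ∧ cdf ν x < 1 := by
  by_contra! hc
  have h01 : ∀ x, cdf ν x = 0 ∨ cdf ν x = 1 := fun x => by
    rcases (cdf_nonneg ν x).eq_or_lt with h0 | h0
    · exact Or.inl h0.symm
    · exact Or.inr (le_antisymm (cdf_le_one ν x) (hc x h0))
  set S := {x | cdf ν x = 1} with hS
  obtain ⟨x1, hx1⟩ := ((tendsto_cdf_atTop ν).eventually (lt_mem_nhds zero_lt_one)).exists
  obtain ⟨x0, hx0⟩ := ((tendsto_cdf_atBot ν).eventually (gt_mem_nhds zero_lt_one)).exists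
  have hne : S.Nonempty := ⟨x1, (h01 x1).resolve_left hx1.ne'⟩
  have hbdd : BddBelow S := ⟨x0, fun y hy => by
    by_contra! hlt
    have := monotone_cdf ν hlt.le
    rw [hS, Set.mem_ofPred_eq] at hy
    linarith⟩
  have hlow : ∀ y < sInf S, cdf ν y = 0 := fun y hy =>
    (h01 y).resolve_right fun h1 => (csInf_le hbdd h1).not_gt hy
  have hup : ∀ y, sInf S < y → cdf ν y = 1 := fun y hy => by
    obtain ⟨z, hz, hzy⟩ := exists_lt_of_csInf_lt hne hy
    refine le_antisymm (cdf_le_one ν y) ?_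
    rw [← show cdf ν z = 1 from hz]
    exact monotone_cdf ν hzy.le
  -- Right-continuity decides the value at the jump itself.
  have hat : cdf ν (sInf S) = 1 := by
    have hr : Tendsto (cdf ν) (𝓝[>] (sInf S)) (𝓝 (cdf ν (sInf S))) :=
      ((cdf ν).right_continuous (sInf S)).mono Set.Ioi_subset_Ici_self
    refine tendsto_nhds_unique hr (tendsto_const_nhds.congr' ?_)
    filter_upwards [self_mem_nhdsWithin] with y hy using (hup y hy).symm
  refine h (sInf S) (Measure.eq_of_cdf _ _ ?_)
  ext y
  rw [cdf_eq_real (Measure.dirac _), measureReal_def, Measure.dirac_apply' _ measurableSet_Iic]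
  rcases lt_or_ge y (sInf S) with hy | hy
  · simp [hlow y hy, hy]
  · rcases hy.eq_or_lt with hy | hy
    · simp [← hy, hat]
    · simp [hup y hy, hy.le]

/-! ### Fréchet laws: max-stability and membership in 𝓓⁻ -/

namespace IsFrechet

/-- At `m + s` the distribution function is exp(-1), a value no point mass attains. -/
theorem nondegenerate {α : ℝ} {ν : Measure ℝ} (h : IsFrechet α ν) : Nondegenerate ν := by
  obtain ⟨m, s, hs, hF⟩ := h
  intro c hc
  have h1 := hF (m + s)
  rw [if_neg (by linarith), show (m + s - m) / s = 1 by field_simp; ring, Real.one_rpow, hc,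
    cdf_eq_real, measureReal_def, Measure.dirac_apply' _ measurableSet_Iic] at h1
  have h2 : Real.exp (-1) < 1 := by simp
  have h3 := Real.exp_pos (-1)
  by_cases hm : c ∈ Set.Iic (m + s)
  · rw [Set.indicator_of_mem hm] at h1
    simp only [Pi.one_apply, ENNReal.toReal_one] at h1
    linarith
  · rw [Set.indicator_of_notMem hm] at h1
    simp at h1
    exact h3.ne h1

variable {α : ℝ} {ν : Measure ℝ} [IsProbabilityMeasure ν]

/-- A Fréchet law is reproduced by the normalised maxima of its own samples. -/
theorem exists_normMaxLaw_eq (hα : 0 < α) (h : IsFrechet α ν) (n : ℕ) :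
    ∃ a b : ℝ, 0 < a ∧ normMaxLaw ν n a b = ν := by
  obtain ⟨m, s, hs, hF⟩ := h
  have hN : (0 : ℝ) < n + 1 := by positivity
  set c : ℝ := ((n : ℝ) + 1) ^ (1 / α) with hc
  have hc0 : 0 < c := Real.rpow_pos_of_pos hN _
  have hca : c ^ (-α) = ((n : ℝ) + 1)⁻¹ := by
    rw [hc, ← Real.rpow_mul hN.le, show 1 / α * -α = -1 by field_simp, Real.rpow_neg_one]
  -- The normalisation contracts by `c` about the location `m`; `c` is a power of `n + 1`, the
  -- actual sample size.
  refine ⟨c⁻¹, c⁻¹ * m - m, inv_pos.2 hc0, ?_⟩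
  have := isProbabilityMeasure_normMaxLaw ν n c⁻¹ (c⁻¹ * m - m)
  refine Measure.eq_of_cdf _ _ ?_
  ext t
  rw [cdf_normMaxLaw ν n (inv_pos.2 hc0),
    show (t + (c⁻¹ * m - m)) / c⁻¹ = m + c * (t - m) by field_simp; ring, hF, hF]
  by_cases ht : t ≤ m
  · rw [if_pos (by nlinarith), if_pos ht, zero_pow n.succ_ne_zero]
  · have ht' : 0 < t - m := by linarith
    rw [if_neg (by nlinarith), if_neg ht, ← Real.exp_nat_mul,
      show (m + c * (t - m) - m) / s = c * ((t - m) / s) by ring,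
      Real.mul_rpow hc0.le (by positivity), hca]
    push_cast
    congr 1
    field_simp

theorem isMaxStable (hα : 0 < α) (h : IsFrechet α ν) : IsMaxStable ν :=
  ⟨h.nondegenerate, h.exists_normMaxLaw_eq hα⟩

theorem inMaxDOA_self (hα : 0 < α) (h : IsFrechet α ν) : InMaxDOA ν ν := by
  choose a b ha hab using h.exists_normMaxLaw_eq hα
  refine ⟨a, b, ha, fun t _ => ?_⟩
  simp only [hab]
  exact tendsto_const_nhds

/-- A convex combination dominates the maximum of the `θ i ^ (1 / α) * X i`, which is again a
Fréchet variable with the same parameters. -/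
theorem dMinus (hα : 0 < α) (hα1 : α ≤ 1) (h : IsFrechet α ν) : DMinus ν := by
  obtain ⟨m, s, hs, hF⟩ := h
  intro n θ hθ hsum t
  have := isProbabilityMeasure_combLaw ν θ
  have hm : ν (Set.Iic m) = 0 := by
    rw [← ofReal_cdf, hF, if_pos le_rfl, ENNReal.ofReal_zero]
  have hae : ∀ᵐ x ∂(Measure.pi (fun _ : Fin n => ν)), ∀ i, m < x i := by
    rw [ae_all_iff]
    intro i
    have : ∀ᵐ y ∂ν, m < y := by
      rw [ae_iff]
      simpa [Set.Iic] using hm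
    exact (measurePreserving_eval (fun _ : Fin n => ν) i).quasiMeasurePreserving.ae this
  have hsumeq : ∀ x : Fin n → ℝ, ∑ i, θ i * x i = m + ∑ i, θ i * (x i - m) := fun x => by
    simp only [mul_sub, Finset.sum_sub_distrib, ← Finset.sum_mul, hsum]
    ring
  have hcomb : cdf (combLaw ν θ) t =
      (Measure.pi (fun _ : Fin n => ν)).real {x | ∑ i, θ i * x i ≤ t} := by
    rw [cdf_eq_real, measureReal_def, combLaw, Measure.map_apply (by fun_prop) measurableSet_Iic]
    rfl
  rw [hcomb]
  have hkey : ∀ᵐ x ∂(Measure.pi (fun _ : Fin n => ν)), ∑ i, θ i * x i ≤ t →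
      m < t ∧ ∀ i, θ i * (x i - m) ≤ t - m := by
    filter_upwards [hae] with x hx hxt
    rw [hsumeq] at hxt
    have hnn : ∀ i ∈ Finset.univ, 0 ≤ θ i * (x i - m) := fun i _ =>
      mul_nonneg (hθ i) (by linarith [hx i])
    refine ⟨?_, fun i => ?_⟩
    -- A positive weight makes the centred sum strictly positive, which settles the boundary case `t
    -- = m`.
    · obtain ⟨j, -, hj⟩ : ∃ j ∈ Finset.univ, 0 < θ j := by
        apply Finset.exists_lt_of_sum_lt
        simp [hsum]
      have := Finset.sum_pos' hnn ⟨j, Finset.mem_univ j, mul_pos hj (by linarith [hx j])⟩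
      linarith
    · have := Finset.single_le_sum hnn (Finset.mem_univ i)
      linarith
  by_cases ht : t ≤ m
  · rw [hF, if_pos ht]
    apply le_of_eq
    rw [measureReal_eq_zero_iff, ← ae_eq_empty, eventuallyEq_set]
    filter_upwards [hkey] with x hx
    simp only [Set.mem_empty_iff_false, iff_false]
    exact fun hxt => (hx hxt).1.not_ge ht
  have htm : 0 < t - m := by linarith
  -- A zero weight imposes no constraint; the division convention would instead give the null set
  -- `Set.Iic m`.
  set A : Fin n → Set ℝ := fun i =>
    if θ i = 0 then Set.univ else Set.Iic (m + (t - m) / θ i ^ (1 / α)) with hA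
  have hAi : ∀ i, ν.real (A i) = Real.exp (-(θ i * ((t - m) / s) ^ (-α))) := fun i => by
    by_cases hi : θ i = 0
    · simp [hA, hi]
    · have hpos : 0 < θ i := lt_of_le_of_ne (hθ i) (Ne.symm hi)
      have hp : 0 < θ i ^ (1 / α) := Real.rpow_pos_of_pos hpos _
      have hq : 0 < (t - m) / θ i ^ (1 / α) := div_pos htm hp
      simp only [hA, if_neg hi]
      rw [← cdf_eq_real, hF, if_neg (by linarith),
        show (m + (t - m) / θ i ^ (1 / α) - m) / s = (t - m) / s / θ i ^ (1 / α) by ring,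
        Real.div_rpow (by positivity) hp.le, ← Real.rpow_mul hpos.le,
        show 1 / α * -α = -1 by field_simp, Real.rpow_neg_one]
      congr 1
      field_simp
  calc (Measure.pi (fun _ : Fin n => ν)).real {x | ∑ i, θ i * x i ≤ t}
      ≤ (Measure.pi (fun _ : Fin n => ν)).real (Set.univ.pi A) := by
        refine ENNReal.toReal_mono (measure_ne_top _ _) (measure_mono_ae ?_)
        filter_upwards [hkey, hae] with x hx hxm hxt i _
        by_cases hi : θ i = 0
        · simp [hA, hi]
        · have hpos : 0 < θ i := lt_of_le_of_ne (hθ i) (Ne.symm hi)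
          have hθ1 : θ i ≤ 1 := by
            rw [← hsum]
            exact Finset.single_le_sum (fun j _ => hθ j) (Finset.mem_univ i)
          -- This is where `α ≤ 1` enters.
          have hle : θ i ^ (1 / α) ≤ θ i := by
            conv_rhs => rw [← Real.rpow_one (θ i)]
            exact Real.rpow_le_rpow_of_exponent_ge hpos hθ1 ((le_div_iff₀ hα).2 (by linarith))
          simp only [hA, if_neg hi, Set.mem_Iic]
          have hp : 0 < θ i ^ (1 / α) := Real.rpow_pos_of_pos hpos _
          rw [← sub_le_iff_le_add', le_div_iff₀ hp, mul_comm]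
          exact (mul_le_mul_of_nonneg_right hle (by linarith [hxm i])).trans ((hx hxt).2 i)
    _ = ∏ i, ν.real (A i) := by
        simp [measureReal_def, Measure.pi_pi, ENNReal.toReal_prod]
    _ = Real.exp (-(((t - m) / s) ^ (-α))) := by
        simp_rw [hAi]
        rw [← Real.exp_sum, Finset.sum_neg_distrib, ← Finset.sum_mul, hsum, one_mul]
    _ = cdf ν t := by rw [hF, if_neg ht]

end IsFrechet

/-! ### Convergence of types -/

/-- If affine maps carry two fixed levels of an asymptotically fixed distribution function to
nondegenerate levels, then their coefficients are eventually bounded. -/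
theorem eventually_abs_le_of_tendsto_comp {H : ℕ → ℝ → ℝ} (hH : ∀ n, Monotone (H n))
    {α β : ℕ → ℝ} {y₀ y₁ x₁ x₂ u₀ u₁ v₁ v₂ : ℝ} (hx : x₁ < x₂)
    (hy₀ : Tendsto (fun n => H n y₀) atTop (𝓝 u₀)) (hy₁ : Tendsto (fun n => H n y₁) atTop (𝓝 u₁))
    (h₁ : Tendsto (fun n => H n (α n * x₁ + β n)) atTop (𝓝 v₁))
    (h₂ : Tendsto (fun n => H n (α n * x₂ + β n)) atTop (𝓝 v₂))
    (h01 : u₀ < v₁) (h02 : u₀ < v₂) (h11 : v₁ < u₁) (h12 : v₂ < u₁) :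
    ∃ C, ∀ᶠ n in atTop, |α n| ≤ C ∧ |β n| ≤ C := by
  have key : ∀ {x v : ℝ}, Tendsto (fun n => H n (α n * x + β n)) atTop (𝓝 v) → u₀ < v → v < u₁ →
      ∀ᶠ n in atTop, y₀ < α n * x + β n ∧ α n * x + β n < y₁ := fun h h0 h1 => by
    filter_upwards [hy₀.eventually_lt h h0, h.eventually_lt hy₁ h1] with n hn0 hn1
    exact ⟨(hH n).reflect_lt hn0, (hH n).reflect_lt hn1⟩
  set A := (y₁ - y₀) / (x₂ - x₁) with hA
  refine ⟨A + |y₀| + |y₁| + A * |x₁|, ?_⟩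
  filter_upwards [key h₁ h01 h11, key h₂ h02 h12] with n hn1 hn2
  have hd : 0 < x₂ - x₁ := by linarith
  have hA0 : 0 ≤ A := div_nonneg (by linarith [hn1.1, hn1.2]) hd.le
  have ha : |α n| ≤ A := by
    rw [hA, le_div_iff₀ hd, ← abs_of_pos hd, ← abs_mul, abs_le]
    constructor <;> nlinarith [hn1.1, hn1.2, hn2.1, hn2.2]
  have hb : |β n| ≤ |y₀| + |y₁| + A * |x₁| := by
    have h1 : |α n * x₁| ≤ A * |x₁| := by
      rw [abs_mul]
      exact mul_le_mul_of_nonneg_right ha (abs_nonneg _)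
    rw [abs_le] at h1 ⊢
    constructor <;> linarith [hn1.1, hn1.2, neg_abs_le y₀, le_abs_self y₁, abs_nonneg y₁,
      abs_nonneg y₀, h1.1, h1.2]
  have := mul_nonneg hA0 (abs_nonneg x₁)
  constructor <;> linarith [abs_nonneg y₀, abs_nonneg y₁]

theorem exists_notMem_Ioo_of_countable {D : Set ℝ} (hD : D.Countable) {a b : ℝ} (hab : a < b) :
    ∃ x, x ∉ D ∧ a < x ∧ x < b := by
  obtain ⟨x, hx, hx'⟩ := (hD.dense_compl ℝ).exists_between hab
  exact ⟨x, hx, hx'⟩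

/-- Right-continuity keeps `F` below 1 just to the right of `x₀`. Two distinct points are needed to
control both slope and intercept of an affine map. -/
theorem exists_two_levels {F : ℝ → ℝ} (hmono : Monotone F)
    (hrc : ∀ x, ContinuousWithinAt F (Set.Ici x) x) {x₀ : ℝ} (h1 : F x₀ < 1)
    {D : Set ℝ} (hD : D.Countable) :
    ∃ x₁ x₂, x₁ < x₂ ∧ x₁ ∉ D ∧ x₂ ∉ D ∧ F x₀ ≤ F x₁ ∧ F x₁ ≤ F x₂ ∧ F x₂ < 1 := by
  have h := (hrc x₀).eventually (gt_mem_nhds h1)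
  obtain ⟨u, hu, hsub⟩ := (mem_nhdsGE_iff_exists_Ico_subset).1 h
  obtain ⟨x₂, hx₂, hx₂a, hx₂b⟩ := exists_notMem_Ioo_of_countable hD hu
  obtain ⟨x₁, hx₁, hx₁a, hx₁b⟩ := exists_notMem_Ioo_of_countable hD hx₂a
  exact ⟨x₁, x₂, hx₁b, hx₁, hx₂, hmono hx₁a.le, hmono hx₁b.le, hsub ⟨hx₂a.le, hx₂b⟩⟩

/-- Below any level in `(0, 1]`, resp. above any level in `[0, 1)`, there are arguments off a
countable set. -/
theorem exists_notMem_lt_gt {F : ℝ → ℝ} (hbot : Tendsto F atBot (𝓝 0))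
    (htop : Tendsto F atTop (𝓝 1)) {D : Set ℝ} (hD : D.Countable) {p q : ℝ} (hp : 0 < p)
    (hq : q < 1) : ∃ y₀ y₁, y₀ ∉ D ∧ y₁ ∉ D ∧ F y₀ < p ∧ q < F y₁ := by
  obtain ⟨a, ha⟩ := eventually_atBot.1 (hbot.eventually (gt_mem_nhds hp))
  obtain ⟨b, hb⟩ := eventually_atTop.1 (htop.eventually (lt_mem_nhds hq))
  obtain ⟨y₀, hy₀, -, hy₀'⟩ := exists_notMem_Ioo_of_countable hD (sub_one_lt a)
  obtain ⟨y₁, hy₁, hy₁', -⟩ := exists_notMem_Ioo_of_countable hD (lt_add_one b)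
  exact ⟨y₀, y₁, hy₀, hy₁, ha _ hy₀'.le, hb _ hy₁'.le⟩

/-- Khinchine's convergence of types theorem. -/
theorem exists_affine_of_tendsto_comp {H : ℕ → ℝ → ℝ} (hH : ∀ n, Monotone (H n))
    {α β : ℕ → ℝ} (hα : ∀ n, 0 < α n) {U V : ℝ → ℝ} (hU : Monotone U) (hV : Monotone V)
    (hUr : ∀ x, ContinuousWithinAt U (Set.Ici x) x) (hVr : ∀ x, ContinuousWithinAt V (Set.Ici x) x)
    (hU0 : Tendsto U atBot (𝓝 0)) (hU1 : Tendsto U atTop (𝓝 1))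
    (hV0 : Tendsto V atBot (𝓝 0)) (hV1 : Tendsto V atTop (𝓝 1))
    {xU xV : ℝ} (hxU0 : 0 < U xU) (hxU1 : U xU < 1) (hxV0 : 0 < V xV) (hxV1 : V xV < 1)
    {D : Set ℝ} (hD : D.Countable) (hHU : ∀ x ∉ D, Tendsto (fun n => H n x) atTop (𝓝 (U x)))
    (hHV : ∀ x ∉ D, Tendsto (fun n => H n (α n * x + β n)) atTop (𝓝 (V x))) :
    ∃ a b : ℝ, 0 < a ∧ ∀ x, V x = U (a * x + b) := by
  obtain ⟨C, hC⟩ : ∃ C, ∀ᶠ n in atTop, |α n| ≤ C ∧ |β n| ≤ C := by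
    obtain ⟨x₁, x₂, h12, h1, h2, hl, hm, hr⟩ := exists_two_levels hV hVr hxV1 hD
    obtain ⟨y₀, y₁, hy₀, hy₁, hl', hr'⟩ :=
      exists_notMem_lt_gt hU0 hU1 hD hxV0 hr
    exact eventually_abs_le_of_tendsto_comp hH h12 (hHU _ hy₀) (hHU _ hy₁) (hHV _ h1) (hHV _ h2)
      (by linarith) (by linarith) (by linarith) hr'
  -- The same bound for the inverse maps, with `U` and `V` exchanged, keeps the limiting slope away
  -- from 0.
  obtain ⟨C', hC'⟩ : ∃ C, ∀ᶠ n in atTop, |(α n)⁻¹| ≤ C ∧ |-(α n)⁻¹ * β n| ≤ C := by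
    obtain ⟨x₁, x₂, h12, h1, h2, hl, hm, hr⟩ := exists_two_levels hU hUr hxU1 hD
    obtain ⟨y₀, y₁, hy₀, hy₁, hl', hr'⟩ :=
      exists_notMem_lt_gt hV0 hV1 hD hxU0 hr
    have hinv : ∀ x n, α n * ((α n)⁻¹ * x + -(α n)⁻¹ * β n) + β n = x := fun x n => by
      have := (hα n).ne'
      field_simp
      ring
    refine eventually_abs_le_of_tendsto_comp (H := fun n x => H n (α n * x + β n))
      (fun n x y hxy => hH n (by have := (hα n).le; gcongr)) h12 (hHV _ hy₀) (hHV _ hy₁)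
      (v₁ := U x₁) (v₂ := U x₂) ?_ ?_ (by linarith) (by linarith) (by linarith) hr'
    · simpa only [hinv] using hHU _ h1
    · simpa only [hinv] using hHU _ h2
  obtain ⟨p, -, φ, hφ, hp⟩ : ∃ p ∈ Set.Icc (-C) C ×ˢ Set.Icc (-C) C, ∃ φ : ℕ → ℕ, StrictMono φ ∧
      Tendsto ((fun n => (α n, β n)) ∘ φ) atTop (𝓝 p) := by
    refine (isCompact_Icc.prod isCompact_Icc).tendsto_subseq' (Eventually.frequently ?_)
    filter_upwards [hC] with n hn
    exact ⟨abs_le.1 hn.1, abs_le.1 hn.2⟩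
  have hpa : Tendsto (fun k => α (φ k)) atTop (𝓝 p.1) := (continuous_fst.tendsto p).comp hp
  have hpb : Tendsto (fun k => β (φ k)) atTop (𝓝 p.2) := (continuous_snd.tendsto p).comp hp
  have hC'0 : 0 < C' := by
    obtain ⟨n, hn⟩ := hC'.exists
    exact (abs_pos.2 (inv_pos.2 (hα n)).ne').trans_le hn.1
  have hpos : 0 < p.1 := by
    refine (inv_pos.2 hC'0).trans_le (ge_of_tendsto hpa ?_)
    filter_upwards [hφ.tendsto_atTop.eventually hC'] with k hk
    have := hk.1
    rw [abs_of_pos (inv_pos.2 (hα _))] at this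
    exact inv_le_of_inv_le₀ (hα _) this
  refine ⟨p.1, p.2, hpos, ?_⟩
  have hlim : ∀ x, Tendsto (fun k => α (φ k) * x + β (φ k)) atTop (𝓝 (p.1 * x + p.2)) := fun x =>
    (hpa.mul_const x).add hpb
  -- The limits are compared only off `D` and across strict gaps; right-continuity of `U` and `V`
  -- closes the gaps afterwards.
  have hupper : ∀ x ∉ D, ∀ y ∉ D, p.1 * x + p.2 < y → V x ≤ U y := fun x hx y hy hxy => by
    refine le_of_tendsto_of_tendsto ((hHV x hx).comp hφ.tendsto_atTop)
      ((hHU y hy).comp hφ.tendsto_atTop) ?_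
    filter_upwards [(hlim x).eventually (gt_mem_nhds hxy)] with k hk using hH _ hk.le
  have hlower : ∀ x ∉ D, ∀ y ∉ D, y < p.1 * x + p.2 → U y ≤ V x := fun x hx y hy hxy => by
    refine le_of_tendsto_of_tendsto ((hHU y hy).comp hφ.tendsto_atTop)
      ((hHV x hx).comp hφ.tendsto_atTop) ?_
    filter_upwards [(hlim x).eventually (lt_mem_nhds hxy)] with k hk using hH _ hk.le
  intro x
  apply le_antisymm
  · have hr : Tendsto U (𝓝[>] (p.1 * x + p.2)) (𝓝 (U (p.1 * x + p.2))) :=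
      (hUr _).mono Set.Ioi_subset_Ici_self
    refine ge_of_tendsto hr ?_
    filter_upwards [self_mem_nhdsWithin] with z hz
    obtain ⟨y, hy, hy1, hy2⟩ := exists_notMem_Ioo_of_countable hD hz
    have hxy : x < (y - p.2) / p.1 := by
      rw [lt_div_iff₀ hpos]
      linarith
    obtain ⟨x', hx', hx1, hx2⟩ := exists_notMem_Ioo_of_countable hD hxy
    rw [lt_div_iff₀ hpos] at hx2
    exact (hV hx1.le).trans ((hupper x' hx' y hy (by linarith)).trans (hU hy2.le))
  · have hr : Tendsto V (𝓝[>] x) (𝓝 (V x)) := (hVr _).mono Set.Ioi_subset_Ici_self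
    refine ge_of_tendsto hr ?_
    filter_upwards [self_mem_nhdsWithin] with z hz
    obtain ⟨x', hx', hx1, hx2⟩ := exists_notMem_Ioo_of_countable hD hz
    have hxy : p.1 * x + p.2 < p.1 * x' + p.2 := by gcongr
    obtain ⟨y, hy, hy1, hy2⟩ := exists_notMem_Ioo_of_countable hD hxy
    exact (hU hy1.le).trans ((hlower x' hx' y hy hy2).trans (hV hx2.le))

/-! ### Real powers of the limiting distribution function -/

/-- A nondegenerate limit of normalised maxima is max-stable in the continuous parameter: all
positive powers of its distribution function are of the same type. -/
theorem InMaxDOA.exists_cdf_affine_eq_rpow {μ ν : Measure ℝ} [IsProbabilityMeasure μ]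
    [IsProbabilityMeasure ν] (h : InMaxDOA μ ν) (hν : Nondegenerate ν) {t : ℝ} (ht : 0 < t) :
    ∃ a b : ℝ, 0 < a ∧ ∀ x, cdf ν (a * x + b) = cdf ν x ^ t := by
  obtain ⟨a, b, ha, hconv⟩ := h
  obtain ⟨x₀, hx0, hx1⟩ := hν.exists_cdf_mem_Ioo
  set D := {x | ¬ ContinuousAt (cdf ν) x} with hDdef
  have hD : D.Countable := (monotone_cdf ν).countable_not_continuousAt
  have hconv' : ∀ x ∉ D, Tendsto (fun n => cdf μ ((x + b n) / a n) ^ (n + 1)) atTop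
      (𝓝 (cdf ν x)) := fun x hx => by
    have := hconv x (not_not.1 hx)
    simpa only [cdf_normMaxLaw μ _ (ha _)] using this
  set k : ℕ → ℕ := fun n => ⌊t * n⌋₊ with hk
  have hkt : Tendsto k atTop atTop :=
    tendsto_nat_floor_atTop.comp (tendsto_natCast_atTop_atTop.const_mul_atTop ht)
  have hratio : Tendsto (fun n : ℕ => ((k n : ℝ) + 1) / (n + 1)) atTop (𝓝 t) := by
    have h1 : Tendsto (fun n : ℕ => ((n : ℝ) + 1)) atTop atTop :=
      tendsto_atTop_add_const_right _ _ tendsto_natCast_atTop_atTop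
    have h2 : Tendsto (fun n : ℕ => t - t / ((n : ℝ) + 1)) atTop (𝓝 t) := by
      simpa using tendsto_const_nhds.sub (tendsto_const_nhds.div_atTop h1 : Tendsto
        (fun n : ℕ => t / ((n : ℝ) + 1)) atTop (𝓝 0))
    have h3 : Tendsto (fun n : ℕ => t + 1 / ((n : ℝ) + 1)) atTop (𝓝 t) := by
      simpa using tendsto_const_nhds.add (tendsto_const_nhds.div_atTop h1 : Tendsto
        (fun n : ℕ => 1 / ((n : ℝ) + 1)) atTop (𝓝 0))
    refine tendsto_of_tendsto_of_tendsto_of_le_of_le h2 h3 (fun n => ?_) (fun n => ?_)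
    · have hn : (0 : ℝ) < n + 1 := by positivity
      have := Nat.lt_floor_add_one (t * n)
      simp only [hk]
      rw [le_div_iff₀ hn, sub_mul, div_mul_cancel₀ _ hn.ne']
      linarith
    · have hn : (0 : ℝ) < n + 1 := by positivity
      have := Nat.floor_le (show 0 ≤ t * n by positivity)
      simp only [hk]
      rw [div_le_iff₀ hn, add_mul, div_mul_cancel₀ _ hn.ne']
      linarith
  -- Maxima of `k n + 1` variables converge to `cdf ν` under their own normalisation. Under the
  -- normalisation of index `n` they converge to `cdf ν ^ t`, since (k n + 1)/(n + 1) → t.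
  obtain ⟨c, d, hc, hcd⟩ := exists_affine_of_tendsto_comp
    (H := fun n x => cdf μ ((x + b (k n)) / a (k n)) ^ (k n + 1))
    (α := fun n => a (k n) / a n) (β := fun n => a (k n) / a n * b n - b (k n))
    (U := cdf ν) (V := fun x => cdf ν x ^ t) (xU := x₀) (xV := x₀)
    (fun n x y hxy => by
      refine pow_le_pow_left₀ (cdf_nonneg μ _) (monotone_cdf μ ?_) _
      have := ha (k n)
      gcongr)
    (fun n => div_pos (ha _) (ha _)) (monotone_cdf ν)
    (fun x y hxy => Real.rpow_le_rpow (cdf_nonneg ν x) (monotone_cdf ν hxy) ht.le)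
    (cdf ν).right_continuous (fun x => ((cdf ν).right_continuous x).rpow_const (Or.inr ht.le))
    (tendsto_cdf_atBot ν) (tendsto_cdf_atTop ν)
    (by simpa [Real.zero_rpow ht.ne'] using (tendsto_cdf_atBot ν).rpow_const (Or.inr ht.le))
    (by simpa using (tendsto_cdf_atTop ν).rpow_const (Or.inr ht.le)) hx0 hx1
    (Real.rpow_pos_of_pos hx0 t) (Real.rpow_lt_one hx0.le hx1 ht) hD
    (fun x hx => (hconv' x hx).comp hkt)
    (fun x hx => by
      have h1 := (hconv' x hx).rpow hratio (Or.inr ht)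
      refine h1.congr fun n => ?_
      have hna := (ha n).ne'
      have hka := (ha (k n)).ne'
      rw [show (a (k n) / a n * x + (a (k n) / a n * b n - b (k n)) + b (k n)) / a (k n) =
        (x + b n) / a n by field_simp; ring, ← Real.rpow_natCast, ← Real.rpow_natCast,
        ← Real.rpow_mul (cdf_nonneg μ _)]
      congr 1
      push_cast
      field_simp)
  exact ⟨c, d, hc, fun x => (hcd x).symm⟩

/-! ### Finite mean when the slope exceeds 1/2 -/

/-- A nonnegative function with summable geometric tails has a finite integral. -/
theorem lintegral_ofReal_ne_top_of_summable_tail {Ω : Type*} [MeasurableSpace Ω] {μ : Measure Ω}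
    [IsProbabilityMeasure μ] {f : Ω → ℝ} (hf : Measurable f) {C r : ℝ} (hC : 0 < C) (hr : 1 < r)
    (hs : Summable fun n : ℕ => r ^ n * μ.real {ω | C * r ^ n < f ω}) :
    ∫⁻ ω, ENNReal.ofReal (f ω) ∂μ ≠ ⊤ := by
  have hr0 : 0 < r := by linarith
  have hmeas : ∀ n : ℕ, MeasurableSet {ω | C * r ^ n < f ω} := fun n =>
    measurableSet_lt measurable_const hf
  have hpt : ∀ ω, ENNReal.ofReal (f ω) ≤ ENNReal.ofReal C +
      ∑' n : ℕ, {ω | C * r ^ n < f ω}.indicator (fun _ => ENNReal.ofReal (C * r ^ (n + 1))) ω := by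
    intro ω
    by_cases h0 : f ω ≤ C
    · exact (ENNReal.ofReal_le_ofReal h0).trans le_self_add
    · push Not at h0
      obtain ⟨n, hn1, hn2⟩ := exists_nat_pow_near (y := r) (x := f ω / C)
        ((one_le_div hC).2 h0.le) hr
      -- The strict inequality moves to the lower end: a value exactly on the grid belongs to the
      -- preceding index.
      have hex : ∃ n : ℕ, C * r ^ n < f ω ∧ f ω ≤ C * r ^ (n + 1) := by
        rw [le_div_iff₀ hC] at hn1
        rw [div_lt_iff₀ hC] at hn2
        rcases hn1.eq_or_lt with h | h
        · rcases n with _ | n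
          · simp at h
            linarith
          · refine ⟨n, ?_, by linarith⟩
            rw [← h, mul_comm, pow_succ]
            have := pow_pos hr0 n
            have : r ^ n * C < r ^ n * r * C := by
              nlinarith [mul_pos this hC]
            linarith
        · exact ⟨n, by linarith, by linarith⟩
      obtain ⟨n, h1, h2⟩ := hex
      calc ENNReal.ofReal (f ω) ≤ ENNReal.ofReal (C * r ^ (n + 1)) := ENNReal.ofReal_le_ofReal h2
        _ = {ω | C * r ^ n < f ω}.indicator (fun _ => ENNReal.ofReal (C * r ^ (n + 1))) ω := by
            rw [Set.indicator_of_mem (show ω ∈ {ω | C * r ^ n < f ω} from h1)]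
        _ ≤ _ := ENNReal.le_tsum (f := fun n : ℕ => {ω | C * r ^ n < f ω}.indicator
            (fun _ => ENNReal.ofReal (C * r ^ (n + 1))) ω) n
        _ ≤ _ := le_add_self
  refine ne_top_of_le_ne_top ?_ (lintegral_mono hpt)
  rw [lintegral_add_left measurable_const, lintegral_tsum
    (fun n => (measurable_const.indicator (hmeas n)).aemeasurable)]
  simp only [lintegral_const, measure_univ, mul_one, lintegral_indicator (hmeas _),
    Measure.restrict_apply MeasurableSet.univ, Set.univ_inter]
  refine ENNReal.add_ne_top.2 ⟨ENNReal.ofReal_ne_top, ?_⟩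
  have heq : ∀ n : ℕ, ENNReal.ofReal (C * r ^ (n + 1)) * μ {ω | C * r ^ n < f ω} =
      ENNReal.ofReal (C * r * (r ^ n * μ.real {ω | C * r ^ n < f ω})) := fun n => by
    rw [← ofReal_measureReal, ← ENNReal.ofReal_mul (by positivity)]
    congr 1
    ring
  simp only [heq]
  exact (hs.mul_left (C * r)).tsum_ofReal_ne_top

theorem iterate_affine_abs_le {a b r : ℝ} (ha : 0 < a) (har : a ≤ r) (hr : 1 < r) (x : ℝ) :
    ∃ C, 0 < C ∧ ∀ n : ℕ, |(fun y => a * y + b)^[n] x| ≤ C * r ^ n := by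
  have hr1 : 0 < r - 1 := by linarith
  set K := |b| / (r - 1) with hK
  have hK0 : 0 ≤ K := div_nonneg (abs_nonneg b) hr1.le
  have hKb : |b| = K * (r - 1) := by rw [hK, div_mul_cancel₀ _ hr1.ne']
  refine ⟨|x| + K + 1, by positivity, fun n => ?_⟩
  -- Adding `K` absorbs the translation, since r|z| + |b| + K = r(|z| + K).
  have key : |(fun y => a * y + b)^[n] x| + K ≤ (|x| + K) * r ^ n := by
    induction n with
    | zero => simp
    | succ n ih =>
      rw [Function.iterate_succ_apply']
      set z := (fun y => a * y + b)^[n] x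
      have h1 : |a * z + b| ≤ r * |z| + |b| := by
        refine (abs_add_le _ _).trans ?_
        rw [abs_mul, abs_of_pos ha]
        gcongr
      calc |a * z + b| + K ≤ r * (|z| + K) := by nlinarith
        _ ≤ r * ((|x| + K) * r ^ n) := by gcongr
        _ = _ := by ring
  have : 0 ≤ r ^ n := by positivity
  nlinarith

/-- If the square of the distribution function is obtained from it by an affine change of variables
with slope larger than `1 / 2`, then the mean is finite. -/
theorem integrable_id_of_cdf_affine_eq_sq {ν : Measure ℝ} [IsProbabilityMeasure ν] {a b x₀ : ℝ}
    (ha : 1 / 2 < a) (h : ∀ x, cdf ν (a * x + b) = cdf ν x ^ 2) (h0 : 0 < cdf ν x₀)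
    (h1 : cdf ν x₀ < 1) : Integrable (fun x : ℝ => x) ν := by
  have ha0 : 0 < a := by linarith
  have hit : ∀ n : ℕ, cdf ν ((fun y => a * y + b)^[n] x₀) = cdf ν x₀ ^ (2 ^ n) := fun n => by
    induction n with
    | zero => simp
    | succ n ih => rw [Function.iterate_succ_apply', h, ih, ← pow_mul, pow_succ]
  have hit' : ∀ n : ℕ, cdf ν ((fun y => a⁻¹ * y + -(a⁻¹ * b))^[n] x₀) ^ (2 ^ n) = cdf ν x₀ :=
    fun n => by
    induction n with
    | zero => simp
    | succ n ih =>
      rw [Function.iterate_succ_apply', pow_succ, mul_comm (2 ^ n) 2, pow_mul, ← h]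
      convert ih using 3
      field_simp
      ring
  have hpos : ∫⁻ x, ENNReal.ofReal x ∂ν ≠ ⊤ := by
    -- The backward orbit of `x₀` grows at most like `r ^ n`, while the upper tail there is
    -- O(2^(-n)). The hypothesis on `a` gives `r < 2`, hence a summable series; 3/2 only ensures `1
    -- < r`.
    set r := max a⁻¹ (3 / 2) with hr
    have hr1 : 1 < r := lt_of_lt_of_le (by norm_num) (le_max_right _ _)
    have hr2 : r < 2 := max_lt (by rw [inv_lt_comm₀ ha0 two_pos]; linarith) (by norm_num)
    obtain ⟨C, hC, hCn⟩ := iterate_affine_abs_le (b := -(a⁻¹ * b)) (inv_pos.2 ha0)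
      (le_max_left a⁻¹ (3 / 2)) hr1 x₀
    refine lintegral_ofReal_ne_top_of_summable_tail measurable_id hC hr1 ?_
    refine Summable.of_nonneg_of_le (fun n => by positivity) (fun n => ?_)
      ((summable_geometric_of_lt_one (r := r / 2) (by linarith) (by linarith)).mul_left
        (-Real.log (cdf ν x₀)))
    have hq0 : 0 ≤ cdf ν (C * r ^ n) := cdf_nonneg _ _
    have hq : cdf ν x₀ ≤ cdf ν (C * r ^ n) ^ (2 ^ n) := by
      rw [← hit' n]
      exact pow_le_pow_left₀ (cdf_nonneg _ _) (monotone_cdf ν ((le_abs_self _).trans (hCn n))) _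
    have hqpos : 0 < cdf ν (C * r ^ n) := by
      refine lt_of_le_of_ne hq0 fun he => ?_
      rw [← he, zero_pow (by positivity)] at hq
      linarith
    have hlog : Real.log (cdf ν x₀) ≤ 2 ^ n * (cdf ν (C * r ^ n) - 1) := by
      refine (Real.log_le_log h0 hq).trans ?_
      rw [Real.log_pow]
      push_cast
      exact mul_le_mul_of_nonneg_left (Real.log_le_sub_one_of_pos hqpos) (by positivity)
    have htail : ν.real {x | C * r ^ n < x} = 1 - cdf ν (C * r ^ n) := by
      rw [cdf_eq_real, ← probReal_compl_eq_one_sub measurableSet_Iic, Set.compl_Iic]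
      rfl
    rw [htail, div_pow]
    have h2n : (0 : ℝ) < 2 ^ n := by positivity
    have hrn : 0 < r ^ n := by positivity
    calc r ^ n * (1 - cdf ν (C * r ^ n)) = r ^ n / 2 ^ n * (2 ^ n * (1 - cdf ν (C * r ^ n))) := by
          field_simp
      _ ≤ r ^ n / 2 ^ n * (-Real.log (cdf ν x₀)) := by
          gcongr
          linarith
      _ = _ := by ring
  have hneg : ∫⁻ x, ENNReal.ofReal (-x) ∂ν ≠ ⊤ := by
    -- Along the forward orbit the lower tail is at most `cdf ν x₀ ^ (2 ^ n)`, which beats any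
    -- geometric growth, so `r` need not be small.
    set r := max a 2 with hr
    have hr1 : 1 < r := lt_of_lt_of_le (by norm_num) (le_max_right _ _)
    obtain ⟨C, hC, hCn⟩ := iterate_affine_abs_le (b := b) ha0 (le_max_left a 2) hr1 x₀
    refine lintegral_ofReal_ne_top_of_summable_tail measurable_id.neg hC hr1 ?_
    have hsum : Summable fun n : ℕ => r ^ n * cdf ν x₀ ^ (2 ^ n) := by
      refine summable_of_ratio_test_tendsto_lt_one (l := 0) zero_lt_one
        (Eventually.of_forall fun n => by positivity) ?_
      have hlim : Tendsto (fun n : ℕ => r * cdf ν x₀ ^ (2 ^ n)) atTop (𝓝 0) := by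
        simpa using ((tendsto_pow_atTop_nhds_zero_of_lt_one h0.le h1).comp
          (tendsto_pow_atTop_atTop_of_one_lt (one_lt_two : (1 : ℕ) < 2))).const_mul r
      refine hlim.congr fun n => ?_
      rw [Real.norm_of_nonneg (by positivity), Real.norm_of_nonneg (by positivity), pow_succ r n,
        pow_succ 2 n, pow_mul]
      have : (cdf ν x₀ ^ 2 ^ n) ≠ 0 := by positivity
      field_simp
    refine Summable.of_nonneg_of_le (fun n => by positivity) (fun n => ?_) hsum
    refine mul_le_mul_of_nonneg_left ?_ (by positivity)
    rw [← hit n, cdf_eq_real]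
    refine measureReal_mono (fun x hx => ?_)
    have h2 := neg_abs_le ((fun y => a * y + b)^[n] x₀)
    have h3 := hCn n
    have hx' : C * r ^ n < -x := hx
    rw [Set.mem_Iic]
    linarith
  refine ⟨measurable_id.aestronglyMeasurable, ?_⟩
  rw [hasFiniteIntegral_iff_norm]
  refine lt_of_le_of_lt (lintegral_mono (g := fun x => ENNReal.ofReal x + ENNReal.ofReal (-x))
    fun x => ?_) ?_
  · rcases le_total 0 x with hx | hx
    · rw [Real.norm_of_nonneg hx]
      exact le_self_add
    · rw [Real.norm_of_nonpos hx]
      exact le_add_self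
  · rw [lintegral_add_left (by fun_prop)]
    exact ENNReal.add_lt_top.2 ⟨hpos.lt_top, hneg.lt_top⟩

/-! ### The law of large numbers excludes a finite mean -/

/-- The average of a sample, seen inside an infinite sequence of independent variables. -/
theorem combLaw_const (ν : Measure ℝ) [IsProbabilityMeasure ν] (n : ℕ) (c : ℝ) :
    combLaw ν (fun _ : Fin n => c) =
      (Measure.infinitePi (fun _ : ℕ => ν)).map (fun ω => c * ∑ i ∈ Finset.range n, ω i) := by
  rw [combLaw, ← Measure.infinitePi_eq_pi,
    ← Measure.map_infinitePi_infinitePi_of_inj (P := fun _ : ℕ => ν) (f := fun i : Fin n => (i : ℕ))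
      Fin.val_injective, Measure.map_map (by fun_prop) (by fun_prop)]
  congr 1
  ext ω
  simp [Finset.mul_sum, Finset.sum_range]

/-- By the law of large numbers, a law in `𝓓⁻` with a finite mean is degenerate. -/
theorem DMinus.not_integrable {ν : Measure ℝ} [IsProbabilityMeasure ν] (h : DMinus ν)
    (hν : Nondegenerate ν) : ¬ Integrable (fun x : ℝ => x) ν := by
  intro hint
  set P := Measure.infinitePi (fun _ : ℕ => ν) with hP
  set M := ∫ x, x ∂ν with hM
  have hmp : ∀ i, MeasurePreserving (fun ω : ℕ → ℝ => ω i) P ν := fun i =>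
    measurePreserving_eval_infinitePi (fun _ : ℕ => ν) i
  have hmean : ∫ ω : ℕ → ℝ, ω 0 ∂P = M := by
    rw [hM, ← (hmp 0).map_eq]
    exact (integral_map (hmp 0).measurable.aemeasurable
      (f := fun x : ℝ => x) measurable_id.aestronglyMeasurable).symm
  have hslln : ∀ᵐ ω : ℕ → ℝ ∂P, Tendsto (fun n : ℕ => (∑ i ∈ Finset.range n, ω i) / n) atTop (𝓝 M) := by
    rw [← hmean]
    refine strong_law_ae_real (fun i (ω : ℕ → ℝ) => ω i) ((hmp 0).integrable_comp_of_integrable hint)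
      (fun i j hij => ?_) (fun i => ?_)
    · exact (iIndepFun_infinitePi (P := fun _ : ℕ => ν) (X := fun _ x => x)
        (fun _ => measurable_id)).indepFun hij
    · exact ⟨(hmp i).measurable.aemeasurable, (hmp 0).measurable.aemeasurable, by
        rw [(hmp i).map_eq, (hmp 0).map_eq]⟩
  -- 𝓓⁻ bounds `cdf ν t` below by the probability that the sample average is at most `t`, which
  -- tends to 1.
  have hone : ∀ t, M < t → cdf ν t = 1 := fun t ht => by
    refine le_antisymm (cdf_le_one ν t) ?_
    have hm := tendstoInMeasure_of_tendsto_ae (fun n => Measurable.aestronglyMeasurable (by fun_prop))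
      hslln
    have hlim := hm (ENNReal.ofReal (t - M)) (by simpa using ht)
    have hlim' : Tendsto (fun n : ℕ => 1 - P.real {ω : ℕ → ℝ | ENNReal.ofReal (t - M) ≤
        edist ((∑ i ∈ Finset.range n, ω i) / n) M}) atTop (𝓝 1) := by
      have := (ENNReal.tendsto_toReal ENNReal.zero_ne_top).comp hlim
      simpa [measureReal_def, Function.comp_def] using tendsto_const_nhds (x := (1 : ℝ)) |>.sub this
    refine le_of_tendsto hlim' ?_
    filter_upwards [eventually_gt_atTop 0] with n hn
    have hn' : (n : ℝ) ≠ 0 := by positivity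
    have hD := h n (fun _ => (n : ℝ)⁻¹) (fun _ => by positivity) (by simp [hn']) t
    refine le_trans ?_ hD
    have := isProbabilityMeasure_combLaw ν (fun _ : Fin n => (n : ℝ)⁻¹)
    rw [cdf_eq_real, combLaw_const, map_measureReal_apply (by fun_prop) measurableSet_Iic,
      sub_le_iff_le_add]
    refine le_trans (le_of_eq (probReal_univ (μ := P)).symm) (le_trans (measureReal_mono ?_)
      (measureReal_union_le _ _))
    intro ω _
    by_cases hω : (n : ℝ)⁻¹ * ∑ i ∈ Finset.range n, ω i ≤ t
    · exact Or.inl hω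
    · right
      rw [inv_mul_eq_div] at hω
      push Not at hω
      rw [Set.mem_ofPred_eq, edist_dist, Real.dist_eq]
      exact ENNReal.ofReal_le_ofReal ((by linarith : t - M ≤ _).trans (le_abs_self _))
  have hle : ∀ᵐ x ∂ν, x ≤ M := by
    have : ∀ k : ℕ, ∀ᵐ x ∂ν, x ≤ M + 1 / ((k : ℝ) + 1) := fun k => by
      have h1 := hone (M + 1 / ((k : ℝ) + 1)) (by linarith [Nat.one_div_pos_of_nat (α := ℝ) (n := k)])
      rw [cdf_eq_real, measureReal_def, ENNReal.toReal_eq_one_iff,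
        ← mem_ae_iff_prob_eq_one measurableSet_Iic] at h1
      exact h1
    filter_upwards [ae_all_iff.2 this] with x hx
    have hl : Tendsto (fun k : ℕ => M + 1 / ((k : ℝ) + 1)) atTop (𝓝 M) := by
      simpa using tendsto_one_div_add_atTop_nhds_zero_nat.const_add M
    exact ge_of_tendsto' hl hx
  -- A variable that never exceeds its own mean equals it almost surely.
  have hzero : ∫ x, (M - x) ∂ν = 0 := by
    rw [integral_sub (integrable_const _) hint]
    simp [hM]
  have hae : (fun x => M - x) =ᵐ[ν] 0 :=
    (integral_eq_zero_iff_of_nonneg_ae (by filter_upwards [hle] with x hx; simpa using hx)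
      ((integrable_const _).sub hint)).1 hzero
  have hconst : (fun x : ℝ => x) =ᵐ[ν] fun _ => M := by
    filter_upwards [hae] with x hx
    simp at hx
    linarith
  refine hν M ?_
  calc ν = ν.map (fun x => x) := Measure.map_id.symm
    _ = ν.map (fun _ => M) := Measure.map_congr hconst
    _ = Measure.dirac M := by simp [Measure.map_const]

/-! ### Solving the functional equation -/

/-- Iterating a nonzero translation would carry a value strictly inside (0, 1) to a limit 0 or 1 at
infinity. -/
theorem eq_zero_of_cdf_add_eq {ν : Measure ℝ} {x₀ δ : ℝ} (h0 : 0 < cdf ν x₀) (h1 : cdf ν x₀ < 1)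
    (h : ∀ x, cdf ν (x + δ) = cdf ν x) : δ = 0 := by
  have hn : ∀ n : ℕ, cdf ν (x₀ + n * δ) = cdf ν x₀ := fun n => by
    induction n with
    | zero => simp
    | succ n ih => rw [← ih, ← h (x₀ + n * δ)]; push_cast; ring_nf
  have hn' : Tendsto (fun n : ℕ => cdf ν (x₀ + n * δ)) atTop (𝓝 (cdf ν x₀)) := by
    simp only [hn]
    exact tendsto_const_nhds
  rcases lt_trichotomy δ 0 with hδ | hδ | hδ
  · refine absurd (tendsto_nhds_unique hn' ((tendsto_cdf_atBot ν).comp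
      (tendsto_atBot_add_const_left _ _
        (tendsto_natCast_atTop_atTop.atTop_mul_const_of_neg hδ)))) h0.ne'
  · exact hδ
  · exact absurd (tendsto_nhds_unique hn' ((tendsto_cdf_atTop ν).comp
      (tendsto_atTop_add_const_left _ _
        (tendsto_natCast_atTop_atTop.atTop_mul_const hδ)))) h1.ne

/-- The analogue for dilations about `m`: a factor above 1 pushes `y₀` to infinity, and a factor
below 1 is inverted first. -/
theorem eq_one_of_cdf_mul_eq {ν : Measure ℝ} {m y₀ c : ℝ} (hy₀ : 0 < y₀)
    (h1 : cdf ν (m + y₀) < 1) (hc : 0 < c)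
    (h : ∀ y, cdf ν (m + c * y) = cdf ν (m + y)) : c = 1 := by
  have key : ∀ d : ℝ, 1 < d → ¬ ∀ y, cdf ν (m + d * y) = cdf ν (m + y) := fun d hd hdy => by
    have hn : ∀ n : ℕ, cdf ν (m + d ^ n * y₀) = cdf ν (m + y₀) := fun n => by
      induction n with
      | zero => simp
      | succ n ih => rw [← ih, ← hdy (d ^ n * y₀), pow_succ]; ring_nf
    have hn' : Tendsto (fun n : ℕ => cdf ν (m + d ^ n * y₀)) atTop (𝓝 (cdf ν (m + y₀))) := by
      simp only [hn]
      exact tendsto_const_nhds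
    exact absurd (tendsto_nhds_unique hn' ((tendsto_cdf_atTop ν).comp
      (tendsto_atTop_add_const_left _ _
        ((tendsto_pow_atTop_atTop_of_one_lt hd).atTop_mul_const hy₀)))) h1.ne
  rcases lt_trichotomy c 1 with hc1 | hc1 | hc1
  · refine absurd (fun y => ?_) (key c⁻¹ ((one_lt_inv₀ hc).2 hc1))
    rw [← h (c⁻¹ * y), mul_inv_cancel_left₀ hc.ne']
  · exact hc1
  · exact absurd h (key c hc1)

/-- An antitone positive multiplicative function on the positive reals is a power function. -/
theorem exists_eq_rpow_of_map_mul {a : ℝ → ℝ} (ha : ∀ t, 0 < t → 0 < a t)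
    (hmul : ∀ t s, 0 < t → 0 < s → a (t * s) = a t * a s)
    (hanti : ∀ t s, 0 < t → t ≤ s → a s ≤ a t) : ∃ ρ : ℝ, ∀ t, 0 < t → a t = t ^ (-ρ) := by
  let f : ℝ →+ ℝ := AddMonoidHom.mk' (fun u => Real.log (a (Real.exp u))) fun u v => by
    rw [Real.exp_add, hmul _ _ (Real.exp_pos u) (Real.exp_pos v),
      Real.log_mul (ha _ (Real.exp_pos u)).ne' (ha _ (Real.exp_pos v)).ne']
  have hf : Antitone f := fun u v huv =>
    Real.log_le_log (ha _ (Real.exp_pos v))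
      (hanti _ _ (Real.exp_pos u) (Real.exp_le_exp.2 huv))
  -- Cauchy's equation in logarithmic coordinates: monotone, hence measurable, hence continuous,
  -- hence linear.
  have hcont : Continuous f := Measure.AddMonoidHom.continuous_of_measurable f hf.measurable
  refine ⟨-f 1, fun t ht => ?_⟩
  have h1 : f (Real.log t) = Real.log t * f 1 := by
    have := map_real_smul f hcont (Real.log t) 1
    simpa using this
  have h2 : f (Real.log t) = Real.log (a t) := by
    change Real.log (a (Real.exp (Real.log t))) = _
    rw [Real.exp_log ht]
  rw [neg_neg, Real.rpow_def_of_pos ht, ← h1, h2, Real.exp_log (ha t ht)]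

/-- A law whose distribution function has all its powers of its own type, the square with slope at
most `1 / 2`, is a Fréchet law with parameter at most `1`. -/
theorem exists_isFrechet_of_cdf_affine_eq_rpow {ν : Measure ℝ} {x₀ : ℝ} (h0 : 0 < cdf ν x₀)
    (h1 : cdf ν x₀ < 1) {a b : ℝ → ℝ} (ha : ∀ t, 0 < t → 0 < a t)
    (hab : ∀ t, 0 < t → ∀ x, cdf ν (a t * x + b t) = cdf ν x ^ t) (h2 : a 2 ≤ 1 / 2) :
    ∃ α : ℝ, 0 < α ∧ α ≤ 1 ∧ IsFrechet α ν := by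
  have ha2 := ha 2 two_pos
  -- `m` is the fixed point of the affine map for t = 2, and becomes the Fréchet location.
  obtain ⟨m, hm⟩ : ∃ m, m * (1 - a 2) = b 2 := ⟨b 2 / (1 - a 2), div_mul_cancel₀ _ (by linarith)⟩
  have hb : ∀ t, 0 < t → b t = m * (1 - a t) := fun t ht => by
    have hat := ha t ht
    -- The maps for 2 and `t`, composed in either order, give the power 2t and differ by a
    -- translation. So they commute, and the map for `t` also fixes `m`.
    have hδ : (a 2 * b t + b 2) - (a t * b 2 + b t) = 0 := by
      refine eq_zero_of_cdf_add_eq h0 h1 fun y => ?_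
      set x := (y - (a t * b 2 + b t)) / (a 2 * a t) with hx
      have hxy : a 2 * a t * x = y - (a t * b 2 + b t) := by
        rw [hx, mul_div_cancel₀ _ (by positivity)]
      have e1 : y + ((a 2 * b t + b 2) - (a t * b 2 + b t)) = a 2 * (a t * x + b t) + b 2 := by
        linear_combination -hxy
      have e2 : y = a t * (a 2 * x + b 2) + b t := by linear_combination -hxy
      rw [e1, hab 2 two_pos, hab t ht]
      conv_rhs => rw [e2, hab t ht, hab 2 two_pos]
      rw [← Real.rpow_mul (cdf_nonneg _ _), ← Real.rpow_mul (cdf_nonneg _ _), mul_comm]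
    have h3 : (b t - m * (1 - a t)) * (1 - a 2) = 0 := by linear_combination -hδ + (a t - 1) * hm
    rcases mul_eq_zero.1 h3 with h | h <;> linarith
  have hH : ∀ t, 0 < t → ∀ y, cdf ν (m + a t * y) = cdf ν (m + y) ^ t := fun t ht y => by
    rw [← hab t ht, hb t ht]
    congr 1
    ring
  have hneg : ∀ y < 0, cdf ν (m + y) = 0 := fun y hy => by
    by_contra hne
    have hpos : 0 < cdf ν (m + y) := lt_of_le_of_ne (cdf_nonneg _ _) (Ne.symm hne)
    -- Moving away from `m` takes square roots, which do not decrease values in [0, 1], although the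
    -- points run to -∞.
    have hn : ∀ n : ℕ, cdf ν (m + y) ≤ cdf ν (m + (a 2)⁻¹ ^ n * y) := fun n => by
      induction n with
      | zero => simp
      | succ n ih =>
        have h4 := hH 2 two_pos ((a 2)⁻¹ ^ (n + 1) * y)
        rw [pow_succ', mul_assoc, mul_inv_cancel_left₀ ha2.ne', ← mul_assoc, ← pow_succ',
          Real.rpow_two] at h4
        nlinarith [cdf_nonneg ν (m + (a 2)⁻¹ ^ (n + 1) * y),
          cdf_le_one ν (m + (a 2)⁻¹ ^ (n + 1) * y)]
    have hlim : Tendsto (fun n : ℕ => cdf ν (m + (a 2)⁻¹ ^ n * y)) atTop (𝓝 0) :=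
      (tendsto_cdf_atBot ν).comp (tendsto_atBot_add_const_left _ _
        ((tendsto_pow_atTop_atTop_of_one_lt
          ((one_lt_inv₀ ha2).2 (by linarith))).atTop_mul_const_of_neg hy))
    exact hpos.not_ge (ge_of_tendsto' hlim hn)
  have hx₀ : m ≤ x₀ := by
    by_contra! hlt
    have := hneg (x₀ - m) (by linarith)
    rw [add_sub_cancel] at this
    linarith
  have hzero : cdf ν m = 0 := by
    have h3 := hH 2 two_pos 0
    rw [mul_zero, add_zero, Real.rpow_two] at h3
    have := monotone_cdf ν hx₀
    nlinarith [cdf_nonneg ν m]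
  obtain ⟨y₀, rfl⟩ : ∃ y₀, x₀ = m + y₀ := ⟨x₀ - m, by ring⟩
  have hy₀ : 0 < y₀ := by
    have : m < m + y₀ := (monotone_cdf ν).reflect_lt (by rw [hzero]; exact h0)
    linarith
  have hanti : ∀ t s, 0 < t → t ≤ s → a s ≤ a t := fun t s ht hts => by
    rcases hts.eq_or_lt with rfl | hlt
    · exact le_rfl
    have h3 : cdf ν (m + a s * y₀) < cdf ν (m + a t * y₀) := by
      rw [hH t ht, hH s (ht.trans hlt)]
      exact Real.rpow_lt_rpow_of_exponent_gt h0 h1 hlt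
    have h4 := (monotone_cdf ν).reflect_lt h3
    exact (lt_of_mul_lt_mul_right (by linarith) hy₀.le).le
  have hmul : ∀ t s, 0 < t → 0 < s → a (t * s) = a t * a s := fun t s ht hs => by
    have hts := mul_pos (ha t ht) (ha s hs)
    have h3 : a (t * s) / (a t * a s) = 1 := by
      refine eq_one_of_cdf_mul_eq hy₀ h1 (div_pos (ha _ (mul_pos ht hs)) hts) fun y => ?_
      have e1 : m + y = m + a t * (a s * (y / (a t * a s))) := by
        rw [← mul_assoc, mul_div_cancel₀ _ hts.ne']
      rw [e1, hH t ht, hH s hs, ← Real.rpow_mul (cdf_nonneg _ _), mul_comm s t,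
        ← hH _ (mul_pos ht hs)]
      congr 1
      ring
    rwa [div_eq_one_iff_eq hts.ne'] at h3
  obtain ⟨ρ, hρ⟩ := exists_eq_rpow_of_map_mul ha hmul hanti
  have hρ1 : 1 ≤ ρ := by
    rw [hρ 2 two_pos, one_div, ← Real.rpow_neg_one, Real.rpow_le_rpow_left_iff one_lt_two] at h2
    linarith
  have hρ0 : 0 < ρ := by linarith
  set L := -Real.log (cdf ν (m + y₀)) with hL
  have hL0 : 0 < L := neg_pos.2 (Real.log_neg h0 h1)
  have hp : 0 < L ^ ρ := Real.rpow_pos_of_pos hL0 _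
  -- For x > m, taking t with `a t` = (x - m)/y₀ gives F(x) = F(m + y₀)^t = exp(-L t); the scale
  -- absorbs `L`.
  refine ⟨1 / ρ, by positivity, (div_le_one hρ0).2 hρ1, m, y₀ * L ^ ρ, by positivity, fun x => ?_⟩
  split_ifs with hx
  · exact le_antisymm (hzero ▸ monotone_cdf ν hx) (cdf_nonneg _ _)
  · push Not at hx
    have hq : 0 < (x - m) / y₀ := div_pos (by linarith) hy₀
    have ht : 0 < ((x - m) / y₀) ^ (-(1 / ρ)) := Real.rpow_pos_of_pos hq _
    have hat : a (((x - m) / y₀) ^ (-(1 / ρ))) = (x - m) / y₀ := by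
      rw [hρ _ ht, ← Real.rpow_mul hq.le, show -(1 / ρ) * -ρ = 1 by field_simp, Real.rpow_one]
    have h3 := hH _ ht y₀
    rw [hat, div_mul_cancel₀ _ hy₀.ne', add_sub_cancel, Real.rpow_def_of_pos h0] at h3
    rw [h3, ← div_div, Real.div_rpow hq.le hp.le, ← Real.rpow_mul hL0.le,
      show ρ * -(1 / ρ) = -1 by field_simp, Real.rpow_neg_one, hL]
    congr 1
    field_simp

theorem DMinus.exists_isFrechet {μ ν : Measure ℝ} [IsProbabilityMeasure μ]
    [IsProbabilityMeasure ν] (hD : DMinus ν) (hν : Nondegenerate ν) (h : InMaxDOA μ ν) :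
    ∃ α : ℝ, 0 < α ∧ α ≤ 1 ∧ IsFrechet α ν := by
  obtain ⟨x₀, h0, h1⟩ := hν.exists_cdf_mem_Ioo
  have hT : ∀ t : ℝ, ∃ a b : ℝ, 0 < t → 0 < a ∧ ∀ x, cdf ν (a * x + b) = cdf ν x ^ t := fun t => by
    by_cases ht : 0 < t
    · obtain ⟨a, b, hab⟩ := h.exists_cdf_affine_eq_rpow hν ht
      exact ⟨a, b, fun _ => hab⟩
    · exact ⟨0, 0, fun h => absurd h ht⟩
  choose a b hab using hT
  refine exists_isFrechet_of_cdf_affine_eq_rpow h0 h1 (fun t ht => (hab t ht).1)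
    (fun t ht => (hab t ht).2) ?_
  by_contra! ha2
  refine hD.not_integrable hν (integrable_id_of_cdf_affine_eq_sq (b := b 2) ha2 (fun x => ?_) h0 h1)
  rw [(hab 2 two_pos).2, Real.rpow_two]

end MaxStableDiv

theorem mainTheorem6 (ν : MeasureTheory.Measure ℝ) [MeasureTheory.IsProbabilityMeasure ν] :
    (∀ μ : MeasureTheory.Measure ℝ, MeasureTheory.IsProbabilityMeasure μ →
      MaxStableDiv.Nondegenerate ν → MaxStableDiv.InMaxDOA μ ν →
        (MaxStableDiv.DMinus ν ↔ ∃ α : ℝ, 0 < α ∧ α ≤ 1 ∧ MaxStableDiv.IsFrechet α ν)) ∧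
    ((∃ α : ℝ, 0 < α ∧ α ≤ 1 ∧ MaxStableDiv.IsFrechet α ν) →
      MaxStableDiv.IsMaxStable ν ∧
        ∃ μ : MeasureTheory.Measure ℝ, MeasureTheory.IsProbabilityMeasure μ ∧
          MaxStableDiv.InMaxDOA μ ν) := by
  refine ⟨fun μ _ hν hDOA => ⟨fun hD => hD.exists_isFrechet hν hDOA, ?_⟩, ?_⟩
  · rintro ⟨α, hα, hα1, hF⟩
    exact hF.dMinus hα hα1
  · rintro ⟨α, hα, -, hF⟩
    -- A Fréchet law lies in its own domain of attraction.
    exact ⟨hF.isMaxStable hα, ν, inferInstance, hF.inMaxDOA_self hα⟩
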